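/- Let $d\ge 1$ be an integer, and let $n,j$ be real numbers with $n>0$, $j\ge 0$ and $\theta:=\frac{j}{n}+\frac{d}{2n}<1$. For complex-valued functions on $\mathbb R^d$, let $F$ be the Fourier transform normalized by $(F^{-1}g)(x)=(2\pi)^{-d/2}\int_{\mathbb R^d}e^{ik\cdot x}g(k)\,dk$, and let $D^s f:=F^{-1}(|k|^sFf)$ $(s\ge 0)$ be the powers of $D=\sqrt{-\Delta}$. These are defined in the Lizorkin sense: let $\Psi$ be the space of Schwartz functions all of whose derivatives of all orders vanish at $0$; for functions $f,h$, each in $L^2(\mathbb R^d,\mathbb C)$ or in $C_0(\mathbb R^d,\mathbb C)$, $h=D^sf$ means $\langle Fh,\psi\rangle=\langle Ff,|k|^s\psi\rangle$ for all $\psi\in\Psi$, where $\langle Ff,\psi\rangle:=\int_{\mathbb R^d} f(x)\,\big(F^{-1}[\psi(-\,\cdot\,)]\big)(x)\,dx$. Let $C_0(\mathbb R^d,\mathbb C)$ be the space of continuous functions vanishing at infinity, with the sup norm $\|\cdot\|_\infty$, and let $H^n:=\{f\in L^2(\mathbb R^d,\mathbb C)\,:\,D^nf\in L^2(\mathbb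 R^d,\mathbb C)\}$. Consider the Sobolev inequality $$D^jf\in C_0(\mathbb R^d,\mathbb C),\qquad \|D^jf\|_\infty\le S\,\sqrt{\|f\|_{2}^2+\|D^nf\|_{2}^2}\qquad\text{for all }f\in H^n,$$ and denote by $S(j,n)$ its sharp constant, i.e. the least $S\in[0,\infty)$ for which it holds (such a least constant exists). Then the Gagliardo–Nirenberg inequality $$D^jf\in C_0(\mathbb R^d,\mathbb C),\qquad \|D^jf\|_\infty\le G\,\|f\|_{2}^{1-\theta}\,\|D^nf\|_{2}^{\theta}\qquad\text{for all }f\in H^n$$ holds for some $G\in[0,\infty)$, and its sharp constant (the least such $G$, which exists) is $$G(j,n)=\frac{S(j,n)}{\sqrt{(1-\theta)^{1-\theta}\theta^{\theta}}} =\frac{1}{2^{d/2}\,\pi^{d/4-1/2}\,\sqrt{\Gamma(d/2)\,(1-\theta)^{1-\theta}\theta^{\theta}\,n\,\sin(\pi\theta)}}.$$ Moreover, the function $$f:=F^{-1}\Big(\frac{|k|^j}{1+|k|^{2n}}\Big)$$ is a maximizer for the Gagliardo–Nirenberg inequality: $f\in H^n\setminus\{0\}$ and $\|D^jf\|_\infty=G(j,n)\,\|f\|_{2}^{1-\theta}\|D^nf\|_{2}^{\theta}$.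 -/

import Mathlib

open MeasureTheory
open scoped SchwartzMap ZeroAtInfty

noncomputable section

namespace GagliardoNirenberg

/-- The Euclidean space `ℝ^d`, with its Euclidean norm and Lebesgue measure. -/
abbrev Space (d : ℕ) : Type := EuclideanSpace ℝ (Fin d)

/-- The complex Hilbert space `L²(ℝ^d, ℂ)`. -/
abbrev L2 (d : ℕ) : Type := Lp ℂ 2 (volume : Measure (Space d))

/-- The inverse Fourier transform with the unitary normalization in angular frequency,
`(F⁻¹ g)(x) = (2π)^(-d/2) ∫ exp(i k·x) g(k) dk`. -/
def invFourier {d : ℕ} (g : Space d → ℂ) (x : Space d) : ℂ :=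
  (((2 * Real.pi) ^ (-(d : ℝ) / 2) : ℝ) : ℂ) *
    ∫ k : Space d, Complex.exp (Complex.I * ((inner ℝ k x : ℝ) : ℂ)) * g k

/-- The Lizorkin-type space `Ψ` of test functions in the wave vector `k`: Schwartz functions all of
whose partial derivatives, of every order `m ≥ 0`, vanish at the origin.
(Their Fourier transforms are the Schwartz functions all of whose moments vanish; these form
the Lizorkin space `Φ`.) -/
def IsLizorkinPsi {d : ℕ} (ψ : 𝓢(Space d, ℂ)) : Prop :=
  ∀ m : ℕ, iteratedFDeriv ℝ m (ψ : Space d → ℂ) 0 = 0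

/-- The Fourier transform `F f ∈ Ψ'` of a function `f` in `L²` or in `C₀`, regarded as an element of
`Φ'` through `⟨f, φ⟩ = ∫ f φ`. It is given by `⟨F f, ψ⟩ = ⟨f, F⁻¹ ψ_R⟩`, where `ψ_R(k) = ψ(-k)`. -/
def fourierPairing {d : ℕ} (f : Space d → ℂ) (ψ : 𝓢(Space d, ℂ)) : ℂ :=
  ∫ x : Space d, f x * invFourier (fun k : Space d => ψ (-k)) x

/-- `IsFracLaplacian s f h` says that `h = D^s f`, where `D = √(-Δ)`: the two functions, as Lizorkin
distributions, satisfy `F h = |k|^s F f` in `Ψ'`, i.e. `⟨F h, ψ⟩ = ⟨F f, |k|^s ψ⟩` for every `ψ ∈ Ψ`.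
Here `χ` is the product `|k|^s ψ`, which is again in `Ψ`. -/
def IsFracLaplacian {d : ℕ} (s : ℝ) (f h : Space d → ℂ) : Prop :=
  ∀ ψ χ : 𝓢(Space d, ℂ), IsLizorkinPsi ψ → IsLizorkinPsi χ →
    (∀ k : Space d, χ k = ((‖k‖ ^ s : ℝ) : ℂ) * ψ k) →
      fourierPairing h ψ = fourierPairing f χ

/-- The `L^∞` Gagliardo–Nirenberg inequality with constant `C`: for all `f ∈ L²` with `g = D^n f ∈ L²`,
`D^j f` is in `C₀(ℝ^d, ℂ)` and `‖D^j f‖_∞ ≤ C ‖f‖₂^(1-θ) ‖D^n f‖₂^θ`. -/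
def GNInequality (d : ℕ) (j n θ C : ℝ) : Prop :=
  ∀ f g : L2 d, IsFracLaplacian n f g →
    ∃ h : C₀(Space d, ℂ), IsFracLaplacian j f h ∧
      ‖h‖ ≤ C * (‖f‖ ^ (1 - θ) * ‖g‖ ^ θ)

/-- The `L^∞` Sobolev inequality with constant `C`: for all `f ∈ L²` with `g = D^n f ∈ L²`,
`D^j f` is in `C₀(ℝ^d, ℂ)` and `‖D^j f‖_∞ ≤ C √(‖f‖₂² + ‖D^n f‖₂²)`. -/
def SobolevInequality (d : ℕ) (j n C : ℝ) : Prop :=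
  ∀ f g : L2 d, IsFracLaplacian n f g →
    ∃ h : C₀(Space d, ℂ), IsFracLaplacian j f h ∧
      ‖h‖ ≤ C * √(‖f‖ ^ 2 + ‖g‖ ^ 2)

/-- `C` is the sharp constant of an inequality depending on a constant: the least constant in
`[0, ∞)` with which it holds. -/
def IsSharpConstant (ineq : ℝ → Prop) (C : ℝ) : Prop :=
  IsLeast {C' : ℝ | 0 ≤ C' ∧ ineq C'} C

/-- `f` is a maximizer of the Gagliardo–Nirenberg inequality with sharp constant `C`: a nonzero
element of `L²` with `g = D^n f ∈ L²` and `h = D^j f ∈ C₀` for which equality holds. -/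
def IsGNMaximizer (d : ℕ) (j n θ C : ℝ) (f : L2 d) : Prop :=
  f ≠ 0 ∧ ∃ (g : L2 d) (h : C₀(Space d, ℂ)), IsFracLaplacian n f g ∧ IsFracLaplacian j f h ∧
    ‖h‖ = C * (‖f‖ ^ (1 - θ) * ‖g‖ ^ θ)

/-- The function `F⁻¹( |k|^j / (1 + |k|^(2n)) )`. -/
def extremal (d : ℕ) (j n : ℝ) : Space d → ℂ :=
  invFourier (fun k : Space d => ((‖k‖ ^ j / (1 + ‖k‖ ^ (2 * n)) : ℝ) : ℂ))

end GagliardoNirenberg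

end

/-! On the Fourier side everything is weighted Cauchy–Schwarz. Up to normalization, `‖D^j f‖_∞ ≤ ∫
|k|^j |Ff|`, and splitting the integrand with the weight `a + b|k|^(2n)` gives `X² ≤ K a^(θ-1)
b^(-θ) (a‖f‖² + b‖D^n f‖²)` for all `a, b > 0`, where `X` is that integral and `K` (`sobolevSq`) is
an explicit radial integral (`integral_weight`, `sq_integral_le_weighted`). Taking `a = b = 1` gives
Sobolev with constant `√K`; optimizing `a, b` gives Gagliardo–Nirenberg with `√K / √m`, `m =
(1-θ)^(1-θ) θ^θ` (`sq_le_of_weighted`).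

The extremal function gives equality in Cauchy–Schwarz at `a = b = 1` (`exists_sobolev_extremal`).
For it, Gagliardo–Nirenberg followed by Young (`young_product_le`) bounds `‖D^j f‖_∞` by the Sobolev
right-hand side, which it attains, so every link is an equality and both constants are sharp. Since
the inequalities only assert that some `h ∈ C₀` exists, sharpness also needs `D^j f` to be unique in
`C₀` (`zeroAtInfty_eq_zero`). -/

/-! ### Mellin integrals and the radial weight -/

open Set in
theorem lintegral_rpow_mul_exp_neg_mul_Ioi {a r : ℝ} (ha : 0 < a) (hr : 0 < r) :
    ∫⁻ t in Ioi (0 : ℝ), ENNReal.ofReal (t ^ (a - 1) * Real.exp (-(r * t))) =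
      ENNReal.ofReal ((1 / r) ^ a * Real.Gamma a) := by
  have h := Real.integral_rpow_mul_exp_neg_mul_Ioi ha hr
  have hpos : 0 < (1 / r) ^ a * Real.Gamma a :=
    mul_pos (by positivity) (Real.Gamma_pos_of_pos ha)
  rw [← h, ofReal_integral_eq_lintegral_ofReal]
  · exact .of_integral_ne_zero (by rw [h]; exact hpos.ne')
  · filter_upwards [ae_restrict_mem measurableSet_Ioi] with t ht
    have : 0 < t := ht
    positivity

-- Write `1/(a + bt)` as `∫ exp(-(a + bt)s) ds` and apply Tonelli: the two Gamma integrals give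
-- `Γ(θ) Γ(1-θ)`, which is `π / sin(πθ)` by reflection.
open Set in
theorem lintegral_rpow_div_add_mul_Ioi {θ a b : ℝ} (h0 : 0 < θ) (h1 : θ < 1)
    (ha : 0 < a) (hb : 0 < b) :
    ∫⁻ t in Ioi (0 : ℝ), ENNReal.ofReal (t ^ (θ - 1) / (a + b * t)) =
      ENNReal.ofReal (a ^ (θ - 1) * b ^ (-θ) * (Real.pi / Real.sin (Real.pi * θ))) := by
  have e1 : ∀ t ∈ Ioi (0 : ℝ), ENNReal.ofReal (t ^ (θ - 1) / (a + b * t)) =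
      ∫⁻ s in Ioi (0 : ℝ), ENNReal.ofReal (t ^ (θ - 1) * Real.exp (-((a + b * t) * s))) := by
    intro t ht
    have ht' : 0 < t := ht
    have h := lintegral_rpow_mul_exp_neg_mul_Ioi one_pos (show 0 < a + b * t by positivity)
    simp only [sub_self, Real.rpow_zero, one_mul, Real.rpow_one, Real.Gamma_one, mul_one] at h
    have hp : 0 ≤ t ^ (θ - 1) := by positivity
    simp_rw [ENNReal.ofReal_mul hp]
    rw [lintegral_const_mul _ (by fun_prop), h, ← ENNReal.ofReal_mul hp]
    simp [div_eq_mul_inv]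
  have e2 : ∀ s ∈ Ioi (0 : ℝ),
      ∫⁻ t in Ioi (0 : ℝ), ENNReal.ofReal (t ^ (θ - 1) * Real.exp (-((a + b * t) * s))) =
        ENNReal.ofReal (b ^ (-θ) * Real.Gamma θ) *
          ENNReal.ofReal (s ^ ((1 - θ) - 1) * Real.exp (-(a * s))) := by
    intro s hs
    have hs' : 0 < s := hs
    have h := lintegral_rpow_mul_exp_neg_mul_Ioi h0 (show 0 < b * s by positivity)
    have hG := Real.Gamma_pos_of_pos h0
    have : ∀ t : ℝ, ENNReal.ofReal (t ^ (θ - 1) * Real.exp (-((a + b * t) * s))) =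
        ENNReal.ofReal (Real.exp (-(a * s))) *
          ENNReal.ofReal (t ^ (θ - 1) * Real.exp (-(b * s * t))) := by
      intro t
      rw [← ENNReal.ofReal_mul (by positivity)]
      congr 1
      rw [mul_left_comm, ← Real.exp_add]
      ring_nf
    simp_rw [this]
    rw [lintegral_const_mul _ (by fun_prop), h, ← ENNReal.ofReal_mul (by positivity),
      ← ENNReal.ofReal_mul (by positivity)]
    congr 1
    rw [one_div, Real.inv_rpow (by positivity), ← Real.rpow_neg (by positivity),
      Real.mul_rpow hb.le hs'.le]
    ring_nf
  rw [setLIntegral_congr_fun measurableSet_Ioi e1, lintegral_lintegral_swap (by fun_prop),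
    setLIntegral_congr_fun measurableSet_Ioi e2, lintegral_const_mul _ (by fun_prop),
    lintegral_rpow_mul_exp_neg_mul_Ioi (by linarith) ha]
  have hG := Real.Gamma_pos_of_pos h0
  rw [← ENNReal.ofReal_mul (by positivity), ← Real.Gamma_mul_Gamma_one_sub, one_div,
    Real.inv_rpow ha.le, ← Real.rpow_neg ha.le]
  congr 1
  rw [neg_sub]
  ring

open Set in
theorem integral_rpow_div_add_mul_Ioi {θ a b : ℝ} (h0 : 0 < θ) (h1 : θ < 1)
    (ha : 0 < a) (hb : 0 < b) :
    ∫ t in Ioi (0 : ℝ), t ^ (θ - 1) / (a + b * t) =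
      a ^ (θ - 1) * b ^ (-θ) * (Real.pi / Real.sin (Real.pi * θ)) := by
  have hs : 0 < Real.sin (Real.pi * θ) :=
    Real.sin_pos_of_pos_of_lt_pi (by positivity) (by nlinarith [Real.pi_pos])
  rw [integral_eq_lintegral_of_nonneg_ae, lintegral_rpow_div_add_mul_Ioi h0 h1 ha hb,
    ENNReal.toReal_ofReal (by positivity)]
  · filter_upwards [ae_restrict_mem measurableSet_Ioi] with t ht
    have : 0 < t := ht
    positivity
  · exact (by fun_prop : Measurable fun t : ℝ => t ^ (θ - 1) / (a + b * t)).aestronglyMeasurable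

namespace GagliardoNirenberg

/-- The square of the sharp constant of the Sobolev inequality. -/
noncomputable def sobolevSq (d : ℕ) (n θ : ℝ) : ℝ :=
  (2 ^ ((d : ℝ) / 2) * Real.pi ^ ((d : ℝ) / 4 - 1 / 2)) ^ (-2 : ℤ) /
    (Real.Gamma ((d : ℝ) / 2) * n * Real.sin (Real.pi * θ))

theorem sobolevSq_pos {d : ℕ} (hd : 1 ≤ d) {n θ : ℝ} (hn : 0 < n) (h0 : 0 < θ) (h1 : θ < 1) :
    0 < sobolevSq d n θ := by
  have hs : 0 < Real.sin (Real.pi * θ) :=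
    Real.sin_pos_of_pos_of_lt_pi (by positivity) (by nlinarith [Real.pi_pos])
  have hd' : (0 : ℝ) < d := by exact_mod_cast hd
  have hG := Real.Gamma_pos_of_pos (show (0 : ℝ) < d / 2 by positivity)
  unfold sobolevSq
  positivity

/-- Polar coordinates and `t = r^(2n)` reduce this to the Mellin integral; `2nθ = 2j + d` matches
the exponents. -/
theorem integral_weight {d : ℕ} (hd : 1 ≤ d) {j n θ a b : ℝ} (hn : 0 < n)
    (hθ : θ = j / n + (d : ℝ) / (2 * n)) (h0 : 0 < θ) (h1 : θ < 1) (ha : 0 < a) (hb : 0 < b) :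
    ∫ ξ : Space d, (2 * Real.pi * ‖ξ‖) ^ (2 * j) / (a + b * (2 * Real.pi * ‖ξ‖) ^ (2 * n)) =
      sobolevSq d n θ * (a ^ (θ - 1) * b ^ (-θ)) := by
  have : Nonempty (Fin d) := ⟨⟨0, hd⟩⟩
  have hd' : (0 : ℝ) < d := by exact_mod_cast hd
  have hpi := Real.pi_pos
  have hG := Real.Gamma_pos_of_pos (show (0 : ℝ) < d / 2 by positivity)
  have hs : 0 < Real.sin (Real.pi * θ) :=
    Real.sin_pos_of_pos_of_lt_pi (by positivity) (by nlinarith [Real.pi_pos])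
  have hexp : 2 * n * θ = 2 * j + d := by rw [hθ]; field_simp
  have : Nontrivial (Space d) := inferInstance
  rw [integral_fun_norm_addHaar volume
    (fun r : ℝ => (2 * Real.pi * r) ^ (2 * j) / (a + b * (2 * Real.pi * r) ^ (2 * n)))]
  have hcongr : ∀ y ∈ Set.Ioi (0 : ℝ),
      y ^ (Module.finrank ℝ (Space d) - 1) •
        ((2 * Real.pi * y) ^ (2 * j) / (a + b * (2 * Real.pi * y) ^ (2 * n))) =
      ((2 * Real.pi) ^ (2 * j) / (2 * n)) * ((2 * n * y ^ (2 * n - 1)) •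
        ((y ^ (2 * n)) ^ (θ - 1) / (a + (b * (2 * Real.pi) ^ (2 * n)) * y ^ (2 * n)))) := by
    intro y hy
    have hy' : 0 < y := hy
    simp only [finrank_euclideanSpace, Fintype.card_fin, smul_eq_mul]
    have e : y ^ (d - 1) * y ^ (2 * j) = y ^ (2 * n - 1) * (y ^ (2 * n)) ^ (θ - 1) := by
      rw [← Real.rpow_natCast, Nat.cast_sub hd, ← Real.rpow_mul hy'.le, ← Real.rpow_add hy',
        ← Real.rpow_add hy']
      congr 1
      push_cast
      linear_combination -hexp
    rw [Real.mul_rpow (by positivity) hy'.le, Real.mul_rpow (by positivity) hy'.le]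
    calc _ = (2 * Real.pi) ^ (2 * j) * (y ^ (d - 1) * y ^ (2 * j)) /
          (a + b * ((2 * Real.pi) ^ (2 * n) * y ^ (2 * n))) := by ring
      _ = _ := by
        rw [e]
        field_simp
  rw [setIntegral_congr_fun measurableSet_Ioi hcongr, integral_const_mul,
    integral_comp_rpow_Ioi_of_pos
      (g := fun t : ℝ => t ^ (θ - 1) / (a + (b * (2 * Real.pi) ^ (2 * n)) * t))
      (show 0 < 2 * n by positivity),
    integral_rpow_div_add_mul_Ioi h0 h1 ha (by positivity), measureReal_def,
    EuclideanSpace.volume_ball]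
  simp only [finrank_euclideanSpace, Fintype.card_fin, smul_eq_mul, nsmul_eq_mul,
    ENNReal.ofReal_one, one_pow, one_mul]
  rw [ENNReal.toReal_ofReal (div_nonneg (by positivity)
    (Real.Gamma_pos_of_pos (by positivity)).le), Real.Gamma_add_one (by positivity),
    Real.mul_rpow hb.le (by positivity), ← Real.rpow_mul (by positivity)]
  -- The powers of `2π` from the frequency scaling collapse to `(2π)^(-d)`.
  have e2 : (2 * Real.pi) ^ (2 * j) * (2 * Real.pi) ^ (2 * n * -θ) =
      (2 ^ ((d : ℝ) / 2) * Real.pi ^ ((d : ℝ) / 2)) ^ (-2 : ℤ) := by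
    rw [← Real.mul_rpow (by positivity) (by positivity), ← Real.rpow_intCast,
      ← Real.rpow_mul (by positivity), ← Real.rpow_add (by positivity)]
    congr 1
    push_cast
    linear_combination -hexp
  have e3 : √Real.pi ^ d = Real.pi ^ ((d : ℝ) / 2) := by
    rw [Real.sqrt_eq_rpow, ← Real.rpow_natCast, ← Real.rpow_mul hpi.le]
    ring_nf
  have e5 : (Real.pi ^ ((d : ℝ) / 4 - 1 / 2)) ^ 2 * Real.pi = Real.pi ^ ((d : ℝ) / 2) := by
    rw [← Real.rpow_natCast, ← Real.rpow_mul hpi.le, ← Real.rpow_add_one hpi.ne']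
    congr 1
    push_cast
    ring
  have hp2 : 0 < Real.pi ^ ((d : ℝ) / 2) := by positivity
  have hp4 : 0 < Real.pi ^ ((d : ℝ) / 4 - 1 / 2) := by positivity
  calc _ = (2 * Real.pi) ^ (2 * j) * (2 * Real.pi) ^ (2 * n * -θ) * (d * √Real.pi ^ d * Real.pi /
        (d / 2 * Real.Gamma (d / 2) * (2 * n) * Real.sin (Real.pi * θ))) *
          (a ^ (θ - 1) * b ^ (-θ)) := by ring
    _ = _ := by
      rw [e2, e3, sobolevSq]
      congr 1
      rw [zpow_neg, zpow_neg]
      simp only [show (2 : ℤ) = ((2 : ℕ) : ℤ) from rfl, zpow_natCast]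
      rw [mul_pow, mul_pow, ← e5]
      field_simp

theorem integrable_weight {d : ℕ} (hd : 1 ≤ d) {j n θ a b : ℝ} (hn : 0 < n)
    (hθ : θ = j / n + (d : ℝ) / (2 * n)) (h0 : 0 < θ) (h1 : θ < 1) (ha : 0 < a) (hb : 0 < b) :
    Integrable fun ξ : Space d =>
      (2 * Real.pi * ‖ξ‖) ^ (2 * j) / (a + b * (2 * Real.pi * ‖ξ‖) ^ (2 * n)) := by
  refine .of_integral_ne_zero ?_
  rw [integral_weight hd hn hθ h0 h1 ha hb]
  have := sobolevSq_pos hd hn h0 h1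
  positivity

/-! ### Passage to the frequency `ξ = k/2π` and the Lizorkin pairing -/

open FourierTransform Filter Topology
open scoped ContDiff

theorem two_pi_ne_zero : (2 * Real.pi : ℝ) ≠ 0 := by positivity

theorem norm_two_pi_smul {d : ℕ} (ξ : Space d) : ‖(2 * Real.pi) • ξ‖ = 2 * Real.pi * ‖ξ‖ := by
  rw [norm_smul, Real.norm_of_nonneg (by positivity)]

theorem integral_comp_two_pi_smul {d : ℕ} (g : Space d → ℂ) :
    ∫ k, g k = (((2 * Real.pi) ^ (d : ℝ) : ℝ) : ℂ) * ∫ ξ, g ((2 * Real.pi) • ξ) := by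
  rw [Measure.integral_comp_smul, finrank_euclideanSpace, Fintype.card_fin,
    abs_of_nonneg (by positivity), Real.rpow_natCast, ← Complex.real_smul, smul_smul,
    mul_inv_cancel₀ (by positivity), one_smul]

theorem invFourier_eq_fourierInv {d : ℕ} (g : Space d → ℂ) (x : Space d) :
    invFourier g x =
      (((2 * Real.pi) ^ ((d : ℝ) / 2) : ℝ) : ℂ) * 𝓕⁻ (fun ξ => g ((2 * Real.pi) • ξ)) x := by
  rw [invFourier, integral_comp_two_pi_smul, ← mul_assoc, ← Complex.ofReal_mul,
    ← Real.rpow_add (by positivity), Real.fourierInv_eq']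
  congr 2
  · congr 2
    ring
  · ext ξ
    rw [smul_eq_mul, inner_smul_left]
    congr 2
    push_cast
    simp
    ring

/-- The Schwartz function `ξ ↦ ψ (2πξ)`. -/
noncomputable def dilate {d : ℕ} (ψ : 𝓢(Space d, ℂ)) : 𝓢(Space d, ℂ) :=
  SchwartzMap.compCLMOfContinuousLinearEquiv ℂ
    (ContinuousLinearEquiv.smulLeft (R₁ := ℝ) (M₁ := Space d)
      (Units.mk0 (2 * Real.pi) two_pi_ne_zero)) ψ

@[simp]
theorem dilate_apply {d : ℕ} (ψ : 𝓢(Space d, ℂ)) (ξ : Space d) :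
    dilate ψ ξ = ψ ((2 * Real.pi) • ξ) := rfl

theorem invFourier_comp_neg {d : ℕ} (ψ : 𝓢(Space d, ℂ)) (x : Space d) :
    invFourier (fun k => ψ (-k)) x =
      (((2 * Real.pi) ^ ((d : ℝ) / 2) : ℝ) : ℂ) * 𝓕 (dilate ψ) x := by
  rw [invFourier_eq_fourierInv, Real.fourierInv_eq_fourier_comp_neg, SchwartzMap.fourier_coe]
  have h : (fun ξ : Space d => ψ (-(2 * Real.pi) • -ξ)) = dilate ψ := by
    ext ξ
    simp
  simp [← h]

theorem fourierPairing_eq {d : ℕ} (f : Space d → ℂ) (ψ : 𝓢(Space d, ℂ)) :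
    fourierPairing f ψ =
      (((2 * Real.pi) ^ ((d : ℝ) / 2) : ℝ) : ℂ) * ∫ x, f x * 𝓕 (dilate ψ) x := by
  rw [fourierPairing, ← integral_const_mul]
  congr 1
  ext x
  rw [invFourier_comp_neg]
  ring

theorem integral_L2_mul_fourier {d : ℕ} (f : L2 d) (φ : 𝓢(Space d, ℂ)) :
    ∫ x, f x * 𝓕 φ x = ∫ ξ, (𝓕 f : L2 d) ξ * φ ξ := by
  have h := DFunLike.congr_fun (Lp.fourier_toTemperedDistribution_eq f) φ
  rw [TemperedDistribution.fourier_apply, Lp.toTemperedDistribution_apply,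
    Lp.toTemperedDistribution_apply] at h
  simpa only [smul_eq_mul, mul_comm] using h

theorem integral_fourierInv_mul_fourier {d : ℕ} {u : Space d → ℂ} (hu : Integrable u)
    (φ : 𝓢(Space d, ℂ)) : ∫ x, 𝓕⁻ u x * 𝓕 φ x = ∫ ξ, u ξ * φ ξ := by
  -- With the pairing `-innerₗ`, the transform of `u` is `𝓕⁻ u` and that of `𝓕 φ` is `φ`.
  have h := VectorFourier.integral_fourierIntegral_smul_eq_flip (𝕜 := ℝ) (e := Real.fourierChar)
    (L := -innerₗ (Space d)) (μ := volume) (ν := volume) (f := u) (g := (𝓕 φ : 𝓢(Space d, ℂ)))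
    Real.continuous_fourierChar (by simp; fun_prop) hu (𝓕 φ : 𝓢(Space d, ℂ)).integrable
  have e1 : VectorFourier.fourierIntegral Real.fourierChar volume (-innerₗ (Space d)) u = 𝓕⁻ u := by
    ext x
    simp [Real.fourierInv_eq, VectorFourier.fourierIntegral]
  have e2 : VectorFourier.fourierIntegral Real.fourierChar volume (-innerₗ (Space d)).flip
      (𝓕 φ : 𝓢(Space d, ℂ)) = φ := by
    have h3 : (𝓕⁻ (𝓕 φ : 𝓢(Space d, ℂ)) : 𝓢(Space d, ℂ)) = φ := fourierInv_fourier_eq φ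
    conv_rhs => rw [← h3, SchwartzMap.fourierInv_coe]
    ext x
    simp [Real.fourierInv_eq, VectorFourier.fourierIntegral, real_inner_comm]
  rw [e1, e2] at h
  simpa only [smul_eq_mul] using h

theorem fourierPairing_L2 {d : ℕ} (f : L2 d) (ψ : 𝓢(Space d, ℂ)) :
    fourierPairing f ψ = (((2 * Real.pi) ^ ((d : ℝ) / 2) : ℝ) : ℂ) *
      ∫ ξ, (𝓕 f : L2 d) ξ * ψ ((2 * Real.pi) • ξ) := by
  rw [fourierPairing_eq, integral_L2_mul_fourier]
  rfl

theorem fourierPairing_fourierInv {d : ℕ} {u : Space d → ℂ} (hu : Integrable u)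
    (ψ : 𝓢(Space d, ℂ)) :
    fourierPairing (𝓕⁻ u) ψ = (((2 * Real.pi) ^ ((d : ℝ) / 2) : ℝ) : ℂ) *
      ∫ ξ, u ξ * ψ ((2 * Real.pi) • ξ) := by
  rw [fourierPairing_eq, integral_fourierInv_mul_fourier hu]
  rfl

theorem contDiff_norm_rpow_mul {d : ℕ} (s : ℝ) {φ : Space d → ℂ} (hφ : ContDiff ℝ ∞ φ)
    (h0 : (0 : Space d) ∉ tsupport φ) :
    ContDiff ℝ ∞ fun k : Space d => ((‖k‖ ^ s : ℝ) : ℂ) * φ k := by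
  rw [contDiff_iff_contDiffAt]
  intro k
  by_cases hk : k = 0
  · subst hk
    have h := notMem_tsupport_iff_eventuallyEq.mp h0
    refine (contDiffAt_const (c := (0 : ℂ))).congr_of_eventuallyEq ?_
    filter_upwards [h] with k hk
    simp [hk]
  · refine ContDiffAt.mul ?_ hφ.contDiffAt
    exact Complex.ofRealCLM.contDiff.contDiffAt.comp k
      ((contDiffAt_norm ℝ hk).rpow_const_of_ne (norm_ne_zero_iff.mpr hk))

theorem isLizorkinPsi_of_eventuallyEq_zero {d : ℕ} {ψ : 𝓢(Space d, ℂ)}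
    (h : (ψ : Space d → ℂ) =ᶠ[𝓝 0] 0) : IsLizorkinPsi ψ := by
  intro m
  rw [(h.iteratedFDeriv ℝ m).eq_of_nhds]
  simp

/-- A smooth function `φ` of the frequency `ξ`, with compact support away from `0`, comes from a
test function `ψ ∈ Ψ` of the wave vector `k = 2πξ`, for which also `|k|^s ψ ∈ Ψ`. -/
theorem exists_lizorkin_pair {d : ℕ} (s : ℝ) {φ : Space d → ℂ} (hφ : ContDiff ℝ ∞ φ)
    (hc : HasCompactSupport φ) (h0 : φ =ᶠ[𝓝 0] 0) :
    ∃ ψ χ : 𝓢(Space d, ℂ), IsLizorkinPsi ψ ∧ IsLizorkinPsi χ ∧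
      (∀ ξ, ψ ((2 * Real.pi) • ξ) = φ ξ) ∧ ∀ k, χ k = ((‖k‖ ^ s : ℝ) : ℂ) * ψ k := by
  have h2 : (2 * Real.pi)⁻¹ ≠ (0 : ℝ) := by positivity
  set ρ : Space d → ℂ := fun k => φ ((2 * Real.pi)⁻¹ • k) with hρ
  have hρs : ContDiff ℝ ∞ ρ := hφ.comp (contDiff_const_smul _)
  have hρc : HasCompactSupport ρ := hc.comp_smul h2
  have hρ0 : ρ =ᶠ[𝓝 0] 0 := by
    have ht : Tendsto (fun k : Space d => (2 * Real.pi)⁻¹ • k) (𝓝 0) (𝓝 0) := by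
      have := (continuous_const_smul ((2 * Real.pi)⁻¹ : ℝ)).tendsto (0 : Space d)
      simpa using this
    filter_upwards [ht.eventually h0] with k hk
    simp only [hρ, hk, Pi.zero_apply]
  refine ⟨hρc.toSchwartzMap hρs,
    (hρc.mul_left (f := fun k : Space d => ((‖k‖ ^ s : ℝ) : ℂ))).toSchwartzMap
      (contDiff_norm_rpow_mul s hρs (notMem_tsupport_iff_eventuallyEq.mpr hρ0)),
    isLizorkinPsi_of_eventuallyEq_zero hρ0,
    isLizorkinPsi_of_eventuallyEq_zero ?_, fun ξ => ?_, fun k => rfl⟩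
  · filter_upwards [hρ0] with k hk
    simp [hk]
  · change φ _ = _
    rw [smul_smul, inv_mul_cancel₀ two_pi_ne_zero, one_smul]

theorem integrable_L2_mul {d : ℕ} (f : L2 d) (φ : 𝓢(Space d, ℂ)) :
    Integrable fun ξ => f ξ * φ ξ :=
  (Lp.memLp f).integrable_mul (φ.memLp 2 volume)

theorem locallyIntegrableOn_mul_L2 {d : ℕ} (f : L2 d) (s : ℝ) :
    LocallyIntegrableOn (fun ξ => (((2 * Real.pi * ‖ξ‖) ^ s : ℝ) : ℂ) * f ξ) {0}ᶜ := by
  have hf : LocallyIntegrableOn f ({0}ᶜ : Set (Space d)) volume :=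
    ((Lp.memLp f).locallyIntegrable one_le_two).locallyIntegrableOn _
  refine hf.continuousOn_mul ?_ isOpen_compl_singleton.isLocallyClosed
  refine Complex.continuous_ofReal.comp_continuousOn ?_
  refine ContinuousOn.rpow_const (by fun_prop) fun x hx => Or.inl ?_
  have : 0 < ‖x‖ := norm_pos_iff.mpr hx
  positivity

theorem ae_ne_zero {d : ℕ} (hd : 1 ≤ d) : ∀ᵐ ξ : Space d, ξ ≠ 0 := by
  have : Nonempty (Fin d) := ⟨⟨0, hd⟩⟩
  have : Nontrivial (Space d) := inferInstance
  exact Measure.ae_ne volume 0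

/-- In `L²`, `g = D^s f` means that the Fourier transforms satisfy `ĝ(ξ) = |2πξ|^s f̂(ξ)` a.e. -/
theorem isFracLaplacian_L2_iff {d : ℕ} (hd : 1 ≤ d) (s : ℝ) (f g : L2 d) :
    IsFracLaplacian s f g ↔ ∀ᵐ ξ, (𝓕 g : L2 d) ξ =
      (((2 * Real.pi * ‖ξ‖) ^ s : ℝ) : ℂ) * (𝓕 f : L2 d) ξ := by
  have hc : (((2 * Real.pi) ^ ((d : ℝ) / 2) : ℝ) : ℂ) ≠ 0 := by
    rw [Complex.ofReal_ne_zero]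
    positivity
  constructor
  · intro h
    have hU : ∀ᵐ ξ : Space d, ξ ∈ ({0}ᶜ : Set (Space d)) →
        (𝓕 g : L2 d) ξ - (((2 * Real.pi * ‖ξ‖) ^ s : ℝ) : ℂ) * (𝓕 f : L2 d) ξ = 0 := by
      -- Test functions supported away from `0` suffice: both sides are locally integrable there,
      -- and the origin is a null set.
      refine isOpen_compl_singleton.ae_eq_zero_of_integral_contDiff_smul_eq_zero ?_ ?_
      · exact (((Lp.memLp _).locallyIntegrable one_le_two).locallyIntegrableOn _).sub
          (locallyIntegrableOn_mul_L2 _ s)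
      · intro φ hφ hcφ hsupp
        have hφ0 : (fun ξ => (φ ξ : ℂ)) =ᶠ[𝓝 0] 0 := by
          have h0 : (0 : Space d) ∉ tsupport φ := fun h' => hsupp h' rfl
          filter_upwards [notMem_tsupport_iff_eventuallyEq.mp h0] with ξ hξ
          simp [hξ]
        obtain ⟨ψ, χ, hψ, hχ, hψφ, hχψ⟩ := exists_lizorkin_pair s
          (Complex.ofRealCLM.contDiff.comp hφ)
          (hcφ.comp_left (g := Complex.ofReal) Complex.ofReal_zero) hφ0
        have key := h ψ χ hψ hχ hχψ
        rw [fourierPairing_L2, fourierPairing_L2] at key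
        have key := mul_left_cancel₀ hc key
        replace hψφ : ∀ ξ, ψ ((2 * Real.pi) • ξ) = φ ξ := hψφ
        have i1 := integrable_L2_mul (𝓕 g : L2 d) (dilate ψ)
        have i2 := integrable_L2_mul (𝓕 f : L2 d) (dilate χ)
        simp only [dilate_apply] at i1 i2
        rw [← sub_eq_zero, ← integral_sub i1 i2] at key
        rw [← key]
        refine integral_congr_ae (ae_of_all _ fun ξ => ?_)
        simp only [hχψ, hψφ, norm_two_pi_smul, Complex.real_smul]
        ring
    filter_upwards [hU, ae_ne_zero hd] with ξ h1 h2
    exact sub_eq_zero.mp (h1 h2)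
  · intro h ψ χ _ _ hχψ
    rw [fourierPairing_L2, fourierPairing_L2]
    congr 1
    refine integral_congr_ae ?_
    filter_upwards [h] with ξ hξ
    simp only [hξ, hχψ, norm_two_pi_smul]
    ring

theorem isFracLaplacian_fourierInv {d : ℕ} (s : ℝ) (f : L2 d)
    (h : Integrable fun ξ => (((2 * Real.pi * ‖ξ‖) ^ s : ℝ) : ℂ) * (𝓕 f : L2 d) ξ) :
    IsFracLaplacian s f
      (𝓕⁻ fun ξ => (((2 * Real.pi * ‖ξ‖) ^ s : ℝ) : ℂ) * (𝓕 f : L2 d) ξ) := by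
  intro ψ χ _ _ hχψ
  rw [fourierPairing_fourierInv h, fourierPairing_L2]
  congr 1
  refine integral_congr_ae (ae_of_all _ fun ξ => ?_)
  simp only [hχψ, norm_two_pi_smul]
  ring

/-! ### Inverse transforms in `C₀` and uniqueness of `D^s f` -/

/-- The inverse Fourier transform of an integrable function, as an element of `C₀`. -/
noncomputable def fourierInvZeroAtInfty {d : ℕ} (u : Space d → ℂ) (hu : Integrable u) :
    C₀(Space d, ℂ) where
  toFun := 𝓕⁻ u
  continuous_toFun := by
    have h := (Real.Lp.fourierTransformInv ((memLp_one_iff_integrable.mpr hu).toLp u)).continuous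
    rwa [Real.Lp.fourierTransformInv_toLp] at h
  zero_at_infty' := by
    -- Riemann–Lebesgue, stated for the forward kernel; reflecting `x` gives the inverse one.
    have h := tendsto_integral_exp_inner_smul_cocompact u
    have h2 := h.comp (Homeomorph.neg (Space d)).isClosedEmbedding.tendsto_cocompact
    refine h2.congr fun x => ?_
    simp [Real.fourierInv_eq]

theorem norm_fourierInvZeroAtInfty_le {d : ℕ} {u : Space d → ℂ} (hu : Integrable u) :
    ‖fourierInvZeroAtInfty u hu‖ ≤ ∫ ξ, ‖u ξ‖ := by
  rw [← ZeroAtInftyContinuousMap.norm_toBCF_eq_norm,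
    BoundedContinuousFunction.norm_le (integral_nonneg fun _ => norm_nonneg _)]
  intro x
  change ‖𝓕⁻ u x‖ ≤ _
  rw [Real.fourierInv_eq]
  refine (norm_integral_le_integral_norm _).trans_eq ?_
  simp_rw [Circle.norm_smul]

/-- The integral is the value at the origin. For nonnegative `u` this matches the upper bound on the
norm. -/
theorem le_norm_fourierInvZeroAtInfty {d : ℕ} {u : Space d → ℂ} (hu : Integrable u) :
    ‖∫ ξ, u ξ‖ ≤ ‖fourierInvZeroAtInfty u hu‖ := by
  rw [← ZeroAtInftyContinuousMap.norm_toBCF_eq_norm]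
  have h := (fourierInvZeroAtInfty u hu).toBCF.norm_coe_le_norm 0
  refine le_trans (le_of_eq ?_) h
  change _ = ‖𝓕⁻ u 0‖
  simp [Real.fourierInv_eq]

theorem integrable_zeroAtInfty_mul {d : ℕ} (h : C₀(Space d, ℂ)) (φ : 𝓢(Space d, ℂ)) :
    Integrable fun x => h x * φ x := by
  refine φ.integrable.bdd_mul (c := ‖h‖) (map_continuous h).aestronglyMeasurable
    (ae_of_all _ fun x => ?_)
  rw [← ZeroAtInftyContinuousMap.norm_toBCF_eq_norm]
  exact h.toBCF.norm_coe_le_norm x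

theorem fourier_modulate_dilate {d : ℕ} (χ : Space d → ℂ) (a x : Space d) {δ : ℝ} (hδ : 0 < δ) :
    𝓕 (fun ξ => (Real.fourierChar (inner ℝ ξ a) : ℂ) * χ (δ • ξ)) x =
      ((δ ^ d)⁻¹ : ℝ) • 𝓕 χ (δ⁻¹ • (x - a)) := by
  have h := Measure.integral_comp_smul (volume : Measure (Space d))
    (fun ξ => Real.fourierChar (-(inner ℝ ξ (δ⁻¹ • (x - a)))) • χ ξ) δ
  rw [finrank_euclideanSpace, Fintype.card_fin, abs_of_pos (by positivity)] at h
  rw [Real.fourier_eq, Real.fourier_eq, ← h]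
  congr 1
  ext ξ
  rw [inner_smul_left, inner_smul_right]
  simp only [conj_trivial]
  rw [mul_inv_cancel_left₀ hδ.ne', Circle.smul_def, Circle.smul_def, smul_eq_mul, smul_eq_mul,
    ← mul_assoc, ← Circle.coe_mul, ← AddChar.map_add_eq_mul, inner_sub_right]
  congr 4
  ring

/-- Modulation by `a` and dilation by `δ` turn the pairing into an average of `H` around `a` at
scale `δ`. -/
theorem integral_mul_fourier_modulate_dilate {d : ℕ} (H χ : Space d → ℂ) (a : Space d) {δ : ℝ}
    (hδ : 0 < δ) :
    ∫ x, H x * 𝓕 (fun ξ => (Real.fourierChar (inner ℝ ξ a) : ℂ) * χ (δ • ξ)) x =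
      ∫ y, H (δ • y + a) * 𝓕 χ y := by
  simp_rw [fourier_modulate_dilate χ a _ hδ]
  rw [← integral_add_right_eq_self (μ := volume) (fun x => H x * _) a]
  have h := Measure.integral_comp_smul (volume : Measure (Space d))
    (fun y => H (δ • y + a) * 𝓕 χ y) δ⁻¹
  rw [finrank_euclideanSpace, Fintype.card_fin, abs_of_pos (by positivity), inv_pow, inv_inv] at h
  have h2 : ∫ y, H (δ • y + a) * 𝓕 χ y = (δ ^ d)⁻¹ •
      ∫ x, H (δ • (δ⁻¹ • x) + a) * 𝓕 χ (δ⁻¹ • x) := by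
    rw [h, smul_smul, inv_mul_cancel₀ (by positivity), one_smul]
  rw [h2, ← integral_smul]
  congr 1
  ext x
  rw [smul_smul, mul_inv_cancel₀ hδ.ne', one_smul, add_sub_cancel_right, mul_smul_comm]

/-- A function in `C₀` that annihilates the Fourier transforms of all smooth functions with compact
support away from the origin is zero. -/
theorem zeroAtInfty_eq_zero {d : ℕ} (hd : 1 ≤ d) (H : C₀(Space d, ℂ))
    (hH : ∀ φ : 𝓢(Space d, ℂ), HasCompactSupport φ → (φ : Space d → ℂ) =ᶠ[𝓝 0] 0 →
      ∫ x, H x * 𝓕 φ x = 0) : H = 0 := by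
  let b : ContDiffBump (0 : Space d) := ⟨1, 2, one_pos, one_lt_two⟩
  have hbs : ContDiff ℝ ∞ (fun ξ => (b ξ : ℂ)) := Complex.ofRealCLM.contDiff.comp b.contDiff
  have hbc : HasCompactSupport (fun ξ => (b ξ : ℂ)) :=
    b.hasCompactSupport.comp_left (g := Complex.ofReal) Complex.ofReal_zero
  have hb1 : ∀ᶠ ξ in 𝓝 (0 : Space d), (b ξ : ℂ) = 1 := by
    filter_upwards [b.eventuallyEq_one] with ξ hξ
    simp [hξ]
  let χ : 𝓢(Space d, ℂ) := hbc.toSchwartzMap hbs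
  let U : 𝓢(Space d, ℂ) := 𝓕 χ
  have hU : ∫ y, U y = 1 := by
    have h1 : (𝓕⁻ (𝓕 χ : 𝓢(Space d, ℂ)) : 𝓢(Space d, ℂ)) = χ := fourierInv_fourier_eq χ
    have h2 : 𝓕⁻ (U : Space d → ℂ) 0 = χ 0 := by
      rw [← SchwartzMap.fourierInv_coe]
      exact DFunLike.congr_fun h1 0
    rw [Real.fourierInv_eq] at h2
    simp only [inner_zero_right, AddChar.map_zero_eq_one, one_smul] at h2
    rw [h2]
    exact hb1.self_of_nhds
  have hbound : ∀ x, ‖H x‖ ≤ ‖H‖ := fun x => by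
    rw [← ZeroAtInftyContinuousMap.norm_toBCF_eq_norm]
    exact H.toBCF.norm_coe_le_norm x
  ext a
  -- The bump is `1` near `0`, so its modulated dilates at scales `δ` and `1` agree there and their
  -- difference is an admissible test function. The average at scale `δ` is thus constant: it tends
  -- to `H a` as `δ → 0` and to `0` as `δ → ∞`.
  have hconst : ∀ δ : ℝ, 0 < δ → ∫ y, H (δ • y + a) * U y = ∫ y, H ((1 : ℝ) • y + a) * U y := by
    intro δ hδ
    let m : Space d → ℂ := fun ξ => (Real.fourierChar (inner ℝ ξ a) : ℂ)
    have hm : ContDiff ℝ ∞ m := by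
      simp only [m, Real.fourierChar_apply]
      have h1 : ContDiff ℝ ∞ fun ξ : Space d => 2 * Real.pi * inner ℝ ξ a :=
        contDiff_const.mul (contDiff_id.inner ℝ contDiff_const)
      exact ((Complex.ofRealCLM.contDiff.comp h1).mul contDiff_const).cexp
    have hs : ∀ t : ℝ, ContDiff ℝ ∞ fun ξ => m ξ * (b (t • ξ) : ℂ) := fun t =>
      hm.mul (hbs.comp (contDiff_const_smul t))
    have hc : ∀ t : ℝ, 0 < t → HasCompactSupport fun ξ => m ξ * (b (t • ξ) : ℂ) := fun t ht =>
      (hbc.comp_smul ht.ne').mul_left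
    let φ : ∀ t : ℝ, 0 < t → 𝓢(Space d, ℂ) := fun t ht => (hc t ht).toSchwartzMap (hs t)
    have hφ1 : ∀ (t : ℝ) (ht : 0 < t), ∀ᶠ ξ in 𝓝 (0 : Space d), φ t ht ξ = m ξ := by
      intro t ht
      have htd : Tendsto (fun ξ : Space d => t • ξ) (𝓝 0) (𝓝 0) := by
        simpa using (continuous_const_smul t).tendsto (0 : Space d)
      filter_upwards [htd.eventually hb1] with ξ hξ
      change m ξ * (b (t • ξ) : ℂ) = m ξ
      rw [hξ, mul_one]
    have key := hH (φ δ hδ - φ 1 one_pos) ?_ ?_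
    · have e : ∀ (t : ℝ) (ht : 0 < t), ∫ x, H x * 𝓕 (φ t ht) x = ∫ y, H (t • y + a) * U y :=
        fun t ht => integral_mul_fourier_modulate_dilate H (fun ξ => (b ξ : ℂ)) a ht
      rw [← e δ hδ, ← e 1 one_pos, ← sub_eq_zero,
        ← integral_sub (integrable_zeroAtInfty_mul H _) (integrable_zeroAtInfty_mul H _), ← key]
      congr 1
      ext x
      have : (𝓕 (φ δ hδ - φ 1 one_pos) : 𝓢(Space d, ℂ)) = 𝓕 (φ δ hδ) - 𝓕 (φ 1 one_pos) :=
        map_sub (fourierCLM ℂ 𝓢(Space d, ℂ)) _ _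
      rw [this, sub_apply, mul_sub]
    · exact (hc δ hδ).sub (hc 1 one_pos)
    · filter_upwards [hφ1 δ hδ, hφ1 1 one_pos] with ξ h1 h2
      simp [h1, h2]
  have hmeas : ∀ δ : ℝ, AEStronglyMeasurable (fun y => H (δ • y + a) * U y) volume := fun δ =>
    Continuous.aestronglyMeasurable
      (((map_continuous H).comp (by fun_prop)).mul U.continuous)
  have hdom : ∀ δ : ℝ, ∀ᵐ y, ‖H (δ • y + a) * U y‖ ≤ ‖H‖ * ‖U y‖ := fun δ =>
    ae_of_all _ fun y => by
      rw [norm_mul]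
      exact mul_le_mul_of_nonneg_right (hbound _) (norm_nonneg _)
  have lim0 : Tendsto (fun δ : ℝ => ∫ y, H (δ • y + a) * U y) (𝓝[>] 0) (𝓝 (∫ y, H a * U y)) := by
    refine tendsto_integral_filter_of_dominated_convergence (fun y => ‖H‖ * ‖U y‖)
      (.of_forall hmeas) (.of_forall hdom) (U.integrable.norm.const_mul _) (ae_of_all _ fun y => ?_)
    refine Tendsto.mul_const _ (((map_continuous H).tendsto a).comp ?_)
    have : Tendsto (fun δ : ℝ => δ • y + a) (𝓝 0) (𝓝 ((0 : ℝ) • y + a)) :=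
      Continuous.tendsto (by fun_prop) 0
    rw [zero_smul, zero_add] at this
    exact this.mono_left nhdsWithin_le_nhds
  have liminfty : Tendsto (fun δ : ℝ => ∫ y, H (δ • y + a) * U y) atTop
      (𝓝 (∫ _ : Space d, (0 : ℂ))) := by
    refine tendsto_integral_filter_of_dominated_convergence (fun y => ‖H‖ * ‖U y‖)
      (.of_forall hmeas) (.of_forall hdom) (U.integrable.norm.const_mul _) ?_
    filter_upwards [ae_ne_zero hd] with y hy
    rw [← zero_mul (U y)]
    refine Tendsto.mul_const _ ((zero_at_infty H).comp ?_)
    rw [← Metric.cobounded_eq_cocompact, ← tendsto_norm_atTop_iff_cobounded]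
    refine tendsto_atTop_mono (f := fun δ : ℝ => δ * ‖y‖ - ‖a‖) (fun δ => ?_) ?_
    · have h1 := norm_sub_le (δ • y + a) a
      rw [add_sub_cancel_right, norm_smul, Real.norm_eq_abs] at h1
      have h2 := mul_le_mul_of_nonneg_right (le_abs_self δ) (norm_nonneg y)
      linarith
    · exact tendsto_atTop_add_const_right _ _
        (tendsto_id.atTop_mul_const (norm_pos_iff.mpr hy))
  have e0 := tendsto_nhds_unique (lim0.congr' (by
    filter_upwards [self_mem_nhdsWithin] with δ hδ using hconst δ hδ)) tendsto_const_nhds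
  have e1 := tendsto_nhds_unique (liminfty.congr' (by
    filter_upwards [eventually_gt_atTop 0] with δ hδ using hconst δ hδ)) tendsto_const_nhds
  rw [integral_zero] at e1
  rw [integral_const_mul, hU, mul_one, ← e1] at e0
  exact e0

theorem isFracLaplacian_zeroAtInfty_unique {d : ℕ} (hd : 1 ≤ d) {s : ℝ} {f : Space d → ℂ}
    {h₁ h₂ : C₀(Space d, ℂ)} (H₁ : IsFracLaplacian s f h₁) (H₂ : IsFracLaplacian s f h₂) :
    h₁ = h₂ := by
  have hc : (((2 * Real.pi) ^ ((d : ℝ) / 2) : ℝ) : ℂ) ≠ 0 := by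
    rw [Complex.ofReal_ne_zero]
    positivity
  rw [← sub_eq_zero]
  refine zeroAtInfty_eq_zero hd _ fun φ hφc hφ0 => ?_
  obtain ⟨ψ, χ, hψ, hχ, hψφ, hχψ⟩ := exists_lizorkin_pair s (φ.smooth ⊤) hφc hφ0
  have key := (H₁ ψ χ hψ hχ hχψ).trans (H₂ ψ χ hψ hχ hχψ).symm
  have hdil : dilate ψ = φ := by
    ext ξ
    exact hψφ ξ
  rw [fourierPairing_eq, fourierPairing_eq, hdil] at key
  have key := mul_left_cancel₀ hc key
  rw [← sub_eq_zero, ← integral_sub (integrable_zeroAtInfty_mul _ _)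
    (integrable_zeroAtInfty_mul _ _)] at key
  rw [← key]
  congr 1
  ext x
  rw [ZeroAtInftyContinuousMap.sub_apply, sub_mul]

/-! ### Weighted Cauchy–Schwarz and its optimization -/

theorem integral_norm_sq_L2 {d : ℕ} (f : L2 d) : ∫ ξ, ‖f ξ‖ ^ 2 = ‖f‖ ^ 2 := by
  have h := L2.inner_def (𝕜 := ℂ) f f
  rw [inner_self_eq_norm_sq_to_K] at h
  have h2 : ∀ ξ, inner ℂ (f ξ) (f ξ) = ((‖f ξ‖ ^ 2 : ℝ) : ℂ) := fun ξ => by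
    rw [inner_self_eq_norm_sq_to_K]
    norm_cast
  simp_rw [h2] at h
  rw [integral_complex_ofReal] at h
  apply Complex.ofReal_injective
  rw [← h]
  push_cast
  rfl

theorem integrable_norm_sq_L2 {d : ℕ} (f : L2 d) : Integrable fun ξ => ‖f ξ‖ ^ 2 :=
  (memLp_two_iff_integrable_sq_norm (Lp.aestronglyMeasurable f)).mp (Lp.memLp f)

theorem integrable_and_integral_le_weighted {d : ℕ} (hd : 1 ≤ d) {j n θ : ℝ} (hn : 0 < n)
    (hθ : θ = j / n + (d : ℝ) / (2 * n)) (h0 : 0 < θ) (h1 : θ < 1)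
    {f g : L2 d} (hfg : IsFracLaplacian n f g) {a b : ℝ}
    (ha : 0 < a) (hb : 0 < b) :
    Integrable (fun ξ => (((2 * Real.pi * ‖ξ‖) ^ j : ℝ) : ℂ) * (𝓕 f : L2 d) ξ) ∧
      ∫ ξ, ‖(((2 * Real.pi * ‖ξ‖) ^ j : ℝ) : ℂ) * (𝓕 f : L2 d) ξ‖ ≤
        (sobolevSq d n θ * (a ^ (θ - 1) * b ^ (-θ)) + (a * ‖f‖ ^ 2 + b * ‖g‖ ^ 2)) / 2 := by
  have hg := (isFracLaplacian_L2_iff hd n f g).mp hfg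
  have iw := integrable_weight hd hn hθ h0 h1 ha hb
  have i1 := (integrable_norm_sq_L2 (𝓕 f : L2 d)).const_mul a
  have i2 := (integrable_norm_sq_L2 (𝓕 g : L2 d)).const_mul b
  have idom := (iw.add (i1.add i2)).div_const 2
  have hle : ∀ᵐ ξ, ‖(((2 * Real.pi * ‖ξ‖) ^ j : ℝ) : ℂ) * (𝓕 f : L2 d) ξ‖ ≤
      ((2 * Real.pi * ‖ξ‖) ^ (2 * j) / (a + b * (2 * Real.pi * ‖ξ‖) ^ (2 * n)) +
        (a * ‖(𝓕 f : L2 d) ξ‖ ^ 2 + b * ‖(𝓕 g : L2 d) ξ‖ ^ 2)) / 2 := by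
    filter_upwards [hg] with ξ hξ
    have hr : 0 ≤ 2 * Real.pi * ‖ξ‖ := by positivity
    have hsq : ∀ t : ℝ, (2 * Real.pi * ‖ξ‖) ^ (2 * t) = ((2 * Real.pi * ‖ξ‖) ^ t) ^ 2 := by
      intro t
      rw [mul_comm 2 t, Real.rpow_mul hr]
      norm_cast
    have hj : 0 ≤ (2 * Real.pi * ‖ξ‖) ^ j := by positivity
    have hn' : 0 ≤ (2 * Real.pi * ‖ξ‖) ^ n := by positivity
    rw [hξ, norm_mul, norm_mul, Complex.norm_of_nonneg hj, Complex.norm_of_nonneg hn', hsq, hsq]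
    set p := (2 * Real.pi * ‖ξ‖) ^ j
    set q := (2 * Real.pi * ‖ξ‖) ^ n
    set y := ‖(𝓕 f : L2 d) ξ‖
    have hq : 0 < a + b * q ^ 2 := by positivity
    -- Cauchy–Schwarz in pointwise AM–GM form, which also supplies the integrable majorant.
    have : p ^ 2 / (a + b * q ^ 2) + (a * y ^ 2 + b * (q * y) ^ 2) - 2 * (p * y) =
        (p - (a + b * q ^ 2) * y) ^ 2 / (a + b * q ^ 2) := by
      field_simp
      ring
    have h2 : 0 ≤ (p - (a + b * q ^ 2) * y) ^ 2 / (a + b * q ^ 2) := by positivity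
    linarith
  have hmeas : AEStronglyMeasurable
      (fun ξ => (((2 * Real.pi * ‖ξ‖) ^ j : ℝ) : ℂ) * (𝓕 f : L2 d) ξ) volume :=
    (by fun_prop : Measurable fun ξ : Space d =>
      (((2 * Real.pi * ‖ξ‖) ^ j : ℝ) : ℂ)).aestronglyMeasurable.mul (Lp.aestronglyMeasurable _)
  have iu := Integrable.mono' idom hmeas hle
  refine ⟨iu, (integral_mono_ae iu.norm idom hle).trans_eq ?_⟩
  simp only [Pi.add_apply]
  rw [integral_div, integral_add iw
    (g := fun ξ => a * ‖(𝓕 f : L2 d) ξ‖ ^ 2 + b * ‖(𝓕 g : L2 d) ξ‖ ^ 2) (i1.add i2),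
    integral_add i1 i2, integral_const_mul, integral_const_mul, integral_norm_sq_L2,
    integral_norm_sq_L2, Lp.norm_fourier_eq, Lp.norm_fourier_eq,
    integral_weight hd hn hθ h0 h1 ha hb]

/-- Scaling `(a, b)` by `t` turns the additive bound into `2X ≤ P/t + tQ`, as `a^(θ-1) b^(-θ)` has
degree `-1`. The choice `t = P/X` yields `X² ≤ PQ` even if `Q = 0`. -/
theorem sq_integral_le_weighted {d : ℕ} (hd : 1 ≤ d) {j n θ : ℝ} (hn : 0 < n)
    (hθ : θ = j / n + (d : ℝ) / (2 * n)) (h0 : 0 < θ) (h1 : θ < 1)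
    {f g : L2 d} (hfg : IsFracLaplacian n f g) {a b : ℝ}
    (ha : 0 < a) (hb : 0 < b) :
    (∫ ξ, ‖(((2 * Real.pi * ‖ξ‖) ^ j : ℝ) : ℂ) * (𝓕 f : L2 d) ξ‖) ^ 2 ≤
      sobolevSq d n θ * (a ^ (θ - 1) * b ^ (-θ)) * (a * ‖f‖ ^ 2 + b * ‖g‖ ^ 2) := by
  have hX : 0 ≤ ∫ ξ, ‖(((2 * Real.pi * ‖ξ‖) ^ j : ℝ) : ℂ) * (𝓕 f : L2 d) ξ‖ :=
    integral_nonneg fun _ => norm_nonneg _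
  have key := fun t (ht : 0 < t) => (integrable_and_integral_le_weighted hd hn hθ h0 h1 hfg
    (mul_pos ht ha) (mul_pos ht hb)).2
  set X := ∫ ξ, ‖(((2 * Real.pi * ‖ξ‖) ^ j : ℝ) : ℂ) * (𝓕 f : L2 d) ξ‖
  have hK := sobolevSq_pos hd hn h0 h1
  set P := sobolevSq d n θ * (a ^ (θ - 1) * b ^ (-θ)) with hP
  have hPpos : 0 < P := by positivity
  rcases hX.eq_or_lt with hX0 | hX0
  · rw [← hX0]
    have : 0 ≤ a * ‖f‖ ^ 2 + b * ‖g‖ ^ 2 := by positivity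
    nlinarith
  · have ht : 0 < P / X := by positivity
    have h := key _ ht
    have e : (P / X * a) ^ (θ - 1) * (P / X * b) ^ (-θ) =
        (P / X)⁻¹ * (a ^ (θ - 1) * b ^ (-θ)) := by
      rw [Real.mul_rpow ht.le ha.le, Real.mul_rpow ht.le hb.le, ← Real.rpow_neg_one,
        show (-1 : ℝ) = (θ - 1) + (-θ) by ring, Real.rpow_add ht]
      ring
    rw [e, mul_left_comm, ← hP, inv_div, div_mul_cancel₀ _ hPpos.ne'] at h
    have h2 : X ≤ P / X * (a * ‖f‖ ^ 2 + b * ‖g‖ ^ 2) := by linarith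
    have h3 := mul_le_mul_of_nonneg_left h2 hX0.le
    calc X ^ 2 = X * X := sq X
      _ ≤ _ := h3
      _ = _ := by field_simp

theorem sq_le_of_weighted {X K F G θ : ℝ} (hK : 0 ≤ K) (hF : 0 ≤ F) (hG : 0 ≤ G)
    (h0 : 0 < θ) (h1 : θ < 1)
    (h : ∀ a b : ℝ, 0 < a → 0 < b →
      X ^ 2 ≤ K * (a ^ (θ - 1) * b ^ (-θ)) * (a * F ^ 2 + b * G ^ 2)) :
    X ^ 2 ≤ K / ((1 - θ) ^ (1 - θ) * θ ^ θ) * (F ^ (1 - θ) * G ^ θ) ^ 2 := by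
  have h1' : 0 < 1 - θ := by linarith
  have hε : ∀ ε : ℝ, 0 < ε → X ^ 2 ≤
      K / ((1 - θ) ^ (1 - θ) * θ ^ θ) * ((F + ε) ^ (1 - θ) * (G + ε) ^ θ) ^ 2 := by
    intro ε hε
    have hF' : 0 < F + ε := by linarith
    have hG' : 0 < G + ε := by linarith
    have hpow : ∀ {c y s : ℝ}, 0 < c → 0 < y → (c / y ^ 2) ^ (-s) = (c ^ s)⁻¹ * (y ^ s) ^ 2 := by
      intro c y s hc hy
      rw [Real.rpow_neg (by positivity), Real.div_rpow hc.le (by positivity), inv_div,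
        ← Real.rpow_natCast, ← Real.rpow_natCast, ← Real.rpow_mul hy.le, ← Real.rpow_mul hy.le,
        mul_comm s]
      field_simp
    -- At `ε = 0` these are the optimal weights, normalized so that `a F² + b G² = 1`; the shift by
    -- `ε` covers vanishing `F` or `G`.
    have hk := h ((1 - θ) / (F + ε) ^ 2) (θ / (G + ε) ^ 2) (by positivity) (by positivity)
    have e1 : (1 - θ) / (F + ε) ^ 2 * F ^ 2 + θ / (G + ε) ^ 2 * G ^ 2 ≤ 1 := by
      have a1 : F ^ 2 / (F + ε) ^ 2 ≤ 1 := (div_le_one (by positivity)).mpr (by gcongr; linarith)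
      have a2 : G ^ 2 / (G + ε) ^ 2 ≤ 1 := (div_le_one (by positivity)).mpr (by gcongr; linarith)
      calc _ = (1 - θ) * (F ^ 2 / (F + ε) ^ 2) + θ * (G ^ 2 / (G + ε) ^ 2) := by ring
        _ ≤ (1 - θ) * 1 + θ * 1 := by gcongr
        _ = 1 := by ring
    refine (hk.trans (mul_le_of_le_one_right (by positivity) e1)).trans_eq ?_
    rw [show θ - 1 = -(1 - θ) by ring, hpow h1' hF', hpow h0 hG']
    field_simp
  have hc : Continuous fun ε : ℝ =>
      K / ((1 - θ) ^ (1 - θ) * θ ^ θ) * ((F + ε) ^ (1 - θ) * (G + ε) ^ θ) ^ 2 := by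
    refine continuous_const.mul (((Continuous.rpow_const (by fun_prop) fun _ => Or.inr h1'.le).mul
      (Continuous.rpow_const (by fun_prop) fun _ => Or.inr h0.le)).pow 2)
  have ht := (hc.tendsto 0).mono_left (nhdsWithin_le_nhds (s := Set.Ioi 0))
  simp only [add_zero] at ht
  refine ge_of_tendsto ht ?_
  filter_upwards [self_mem_nhdsWithin] with ε hε' using hε ε hε'

/-- Weighted AM–GM for `F²/(1-θ)` and `G²/θ`. -/
theorem young_product_le {F G θ : ℝ} (hF : 0 ≤ F) (hG : 0 ≤ G) (h0 : 0 < θ) (h1 : θ < 1) :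
    (F ^ (1 - θ) * G ^ θ) ^ 2 / ((1 - θ) ^ (1 - θ) * θ ^ θ) ≤ F ^ 2 + G ^ 2 := by
  have h1' : 0 < 1 - θ := by linarith
  have h := Real.geom_mean_le_arith_mean2_weighted h1'.le h0.le
    (show 0 ≤ F ^ 2 / (1 - θ) by positivity) (show 0 ≤ G ^ 2 / θ by positivity) (by ring)
  rw [mul_div_cancel₀ _ h1'.ne', mul_div_cancel₀ _ h0.ne', Real.div_rpow (by positivity) h1'.le,
    Real.div_rpow (by positivity) h0.le, div_mul_div_comm] at h
  refine le_trans (le_of_eq ?_) h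
  congr 1
  rw [mul_pow]
  congr 1
  · rw [← Real.rpow_natCast, ← Real.rpow_natCast, ← Real.rpow_mul hF, ← Real.rpow_mul hF, mul_comm]
  · rw [← Real.rpow_natCast, ← Real.rpow_natCast, ← Real.rpow_mul hG, ← Real.rpow_mul hG, mul_comm]

/-! ### The two inequalities and the extremal function -/

theorem sobolevInequality {d : ℕ} (hd : 1 ≤ d) {j n θ : ℝ} (hn : 0 < n)
    (hθ : θ = j / n + (d : ℝ) / (2 * n)) (h0 : 0 < θ) (h1 : θ < 1) :
    SobolevInequality d j n (√(sobolevSq d n θ)) := by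
  intro f g hfg
  have hu := (integrable_and_integral_le_weighted hd hn hθ h0 h1 hfg one_pos one_pos).1
  refine ⟨fourierInvZeroAtInfty _ hu, isFracLaplacian_fourierInv j f hu,
    (norm_fourierInvZeroAtInfty_le hu).trans ?_⟩
  rw [← Real.sqrt_mul (sobolevSq_pos hd hn h0 h1).le]
  refine Real.le_sqrt_of_sq_le ?_
  simpa using sq_integral_le_weighted hd hn hθ h0 h1 hfg one_pos one_pos

theorem gnInequality {d : ℕ} (hd : 1 ≤ d) {j n θ : ℝ} (hn : 0 < n)
    (hθ : θ = j / n + (d : ℝ) / (2 * n)) (h0 : 0 < θ) (h1 : θ < 1) :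
    GNInequality d j n θ (√(sobolevSq d n θ) / √((1 - θ) ^ (1 - θ) * θ ^ θ)) := by
  intro f g hfg
  have hu := (integrable_and_integral_le_weighted hd hn hθ h0 h1 hfg one_pos one_pos).1
  refine ⟨fourierInvZeroAtInfty _ hu, isFracLaplacian_fourierInv j f hu,
    (norm_fourierInvZeroAtInfty_le hu).trans ?_⟩
  have hK := (sobolevSq_pos hd hn h0 h1).le
  have h := sq_le_of_weighted hK (norm_nonneg f) (norm_nonneg g) h0 h1 fun a b ha hb =>
    sq_integral_le_weighted hd hn hθ h0 h1 hfg ha hb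
  rw [← Real.sqrt_div hK]
  refine (Real.le_sqrt_of_sq_le h).trans_eq ?_
  have h1' : 0 < 1 - θ := by linarith
  rw [Real.sqrt_mul (by positivity), Real.sqrt_sq (by positivity)]

/-- On `L¹ ∩ L²`, the inverse Fourier integral agrees with the inverse Fourier transform of `L²`. -/
theorem fourierInv_ae_eq_L2 {d : ℕ} {u : Space d → ℂ} (hu : Integrable u) (hu2 : MemLp u 2 volume) :
    𝓕⁻ u =ᵐ[volume] (𝓕⁻ (hu2.toLp u) : L2 d) := by
  refine ae_eq_of_integral_contDiff_smul_eq ?_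
    ((Lp.memLp _).locallyIntegrable one_le_two) fun φ hφ hφc => ?_
  · exact (map_continuous (fourierInvZeroAtInfty u hu)).locallyIntegrable
  · let φ' : 𝓢(Space d, ℂ) := (hφc.comp_left (g := Complex.ofReal)
      Complex.ofReal_zero).toSchwartzMap (Complex.ofRealCLM.contDiff.comp hφ)
    have h1 := integral_L2_mul_fourier (𝓕⁻ (hu2.toLp u) : L2 d) (𝓕⁻ φ')
    have h2 := integral_fourierInv_mul_fourier hu (𝓕⁻ φ')
    have e1 : (𝓕 (𝓕⁻ φ' : 𝓢(Space d, ℂ)) : 𝓢(Space d, ℂ)) = φ' := fourier_fourierInv_eq φ'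
    have e2 : (𝓕 (𝓕⁻ (hu2.toLp u) : L2 d) : L2 d) = hu2.toLp u := fourier_fourierInv_eq _
    rw [e1] at h1 h2
    rw [e2] at h1
    have h3 : ∫ ξ, (hu2.toLp u) ξ * (𝓕⁻ φ' : 𝓢(Space d, ℂ)) ξ =
        ∫ ξ, u ξ * (𝓕⁻ φ' : 𝓢(Space d, ℂ)) ξ := by
      refine integral_congr_ae ?_
      filter_upwards [hu2.coeFn_toLp] with ξ hξ
      rw [hξ]
    have h4 := h2.trans (h3.symm.trans h1.symm)
    have e3 : ∀ v : Space d → ℂ, ∫ x, φ x • v x = ∫ x, v x * φ' x := fun v => by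
      congr 1
      ext x
      rw [Complex.real_smul, mul_comm]
      rfl
    rw [e3, e3]
    exact h4

theorem rpow_two_mul_eq_sq {r : ℝ} (hr : 0 ≤ r) (t : ℝ) : r ^ (2 * t) = (r ^ t) ^ 2 := by
  rw [mul_comm 2 t, Real.rpow_mul hr]
  norm_cast

/-- The extremal function together with its fractional derivatives, for which the Sobolev
inequality is an equality. -/
theorem exists_sobolev_extremal {d : ℕ} (hd : 1 ≤ d) {j n θ : ℝ} (hj : 0 ≤ j) (hn : 0 < n)
    (hθ : θ = j / n + (d : ℝ) / (2 * n)) (h0 : 0 < θ) (h1 : θ < 1) :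
    ∃ (hf : MemLp (extremal d j n) 2 volume) (g : L2 d) (h : C₀(Space d, ℂ)),
      IsFracLaplacian n (hf.toLp (extremal d j n)) g ∧
      IsFracLaplacian j (hf.toLp (extremal d j n)) h ∧
      0 < ‖hf.toLp (extremal d j n)‖ ^ 2 + ‖g‖ ^ 2 ∧
      √(sobolevSq d n θ) * √(‖hf.toLp (extremal d j n)‖ ^ 2 + ‖g‖ ^ 2) ≤ ‖h‖ := by
  have hd' : (0 : ℝ) < d := by exact_mod_cast hd
  have hK := sobolevSq_pos hd hn h0 h1
  set K := sobolevSq d n θ with hKdef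
  set c : ℝ := (2 * Real.pi) ^ ((d : ℝ) / 2) with hc
  have hcpos : 0 < c := by positivity
  let w : Space d → ℝ := fun ξ => (2 * Real.pi * ‖ξ‖) ^ j / (1 + (2 * Real.pi * ‖ξ‖) ^ (2 * n))
  let q : Space d → ℝ := fun ξ => (2 * Real.pi * ‖ξ‖) ^ n
  let p : Space d → ℝ := fun ξ =>
    (2 * Real.pi * ‖ξ‖) ^ (2 * j) / (1 + (2 * Real.pi * ‖ξ‖) ^ (2 * n))
  have hwm : Measurable w := by fun_prop
  have hqm : Measurable q := by fun_prop
  have hpint : Integrable p := by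
    simpa only [one_mul] using integrable_weight hd hn hθ h0 h1 one_pos one_pos
  have hpval : ∫ ξ, p ξ = K := by
    simpa only [one_mul, Real.one_rpow, mul_one] using
      integral_weight hd hn hθ h0 h1 one_pos one_pos
  have hp0 : ∀ ξ, 0 ≤ p ξ := fun ξ => by positivity
  have hw0 : ∀ ξ, 0 ≤ w ξ := fun ξ => by positivity
  have hq0 : ∀ ξ, 0 ≤ q ξ := fun ξ => by positivity
  -- This and `hpw` express equality in Cauchy–Schwarz: the energy and `D^j f(0)` are both multiples
  -- of `∫ p = K`.
  have hsum : ∀ ξ, (w ξ) ^ 2 + (q ξ * w ξ) ^ 2 = p ξ := fun ξ => by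
    have hr : 0 ≤ 2 * Real.pi * ‖ξ‖ := by positivity
    simp only [w, q, p, rpow_two_mul_eq_sq hr]
    have : 0 < 1 + ((2 * Real.pi * ‖ξ‖) ^ n) ^ 2 := by positivity
    field_simp
  have hpw : ∀ ξ, (2 * Real.pi * ‖ξ‖) ^ j * w ξ = p ξ := fun ξ => by
    have hr : 0 ≤ 2 * Real.pi * ‖ξ‖ := by positivity
    simp only [w, p, rpow_two_mul_eq_sq hr]
    ring
  -- `w` is the weight with `j/2` for `j`; this lowers `θ` by `j/(2n)`, and it stays positive
  -- because `d > 0`.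
  have hwint : Integrable w := by
    have hθ' : θ - j / (2 * n) = j / 2 / n + (d : ℝ) / (2 * n) := by
      rw [hθ]
      field_simp
      ring
    have hpos : 0 < θ - j / (2 * n) := by
      rw [hθ']
      positivity
    have hlt : θ - j / (2 * n) < 1 := by
      have : 0 ≤ j / (2 * n) := by positivity
      linarith
    have h := integrable_weight hd hn hθ' hpos hlt one_pos one_pos
    simpa only [one_mul, mul_div_cancel₀ j (two_ne_zero' ℝ)] using h
  have hwC : Integrable fun ξ => (w ξ : ℂ) := hwint.ofReal
  have hw2 : MemLp (fun ξ => (w ξ : ℂ)) 2 volume := by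
    have hm : AEStronglyMeasurable (fun ξ => (w ξ : ℂ)) volume := hwC.aestronglyMeasurable
    rw [memLp_two_iff_integrable_sq_norm hm]
    refine hpint.mono' (hm.norm.pow 2) (ae_of_all _ fun ξ => ?_)
    rw [Complex.norm_of_nonneg (hw0 ξ), Real.norm_of_nonneg (by positivity), ← hsum]
    have := sq_nonneg (q ξ * w ξ)
    linarith
  have hqw2 : MemLp (fun ξ => ((q ξ * w ξ : ℝ) : ℂ)) 2 volume := by
    have hm : AEStronglyMeasurable (fun ξ => ((q ξ * w ξ : ℝ) : ℂ)) volume :=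
      (Complex.measurable_ofReal.comp (hqm.mul hwm)).aestronglyMeasurable
    rw [memLp_two_iff_integrable_sq_norm hm]
    refine hpint.mono' (hm.norm.pow 2) (ae_of_all _ fun ξ => ?_)
    rw [Complex.norm_of_nonneg (mul_nonneg (hq0 ξ) (hw0 ξ)),
      Real.norm_of_nonneg (by positivity), ← hsum]
    have := sq_nonneg (w ξ)
    linarith
  let f₀ : L2 d := (c : ℂ) • 𝓕⁻ (hw2.toLp _ : L2 d)
  let g : L2 d := (c : ℂ) • 𝓕⁻ (hqw2.toLp _ : L2 d)
  have hext : extremal d j n =ᵐ[volume] f₀ := by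
    have e : ∀ x, extremal d j n x = (c : ℂ) * 𝓕⁻ (fun ξ => (w ξ : ℂ)) x := by
      intro x
      rw [extremal, invFourier_eq_fourierInv]
      simp only [norm_two_pi_smul, w, hc]
    filter_upwards [fourierInv_ae_eq_L2 hwC hw2, Lp.coeFn_smul (c : ℂ) (𝓕⁻ (hw2.toLp _ : L2 d))]
      with x h2 h3
    rw [e, h2, h3]
    rfl
  have hf : MemLp (extremal d j n) 2 volume := (Lp.memLp f₀).ae_eq hext.symm
  have hff₀ : hf.toLp (extremal d j n) = f₀ := by
    apply Lp.ext
    exact hf.coeFn_toLp.trans hext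
  have hsmul : ∀ v : L2 d, (𝓕 ((c : ℂ) • 𝓕⁻ v : L2 d) : L2 d) = (c : ℂ) • v := fun v => by
    rw [fourier_smul, fourier_fourierInv_eq]
  have hFf : ∀ᵐ ξ, (𝓕 f₀ : L2 d) ξ = ((c * w ξ : ℝ) : ℂ) := by
    simp only [f₀]
    rw [hsmul]
    filter_upwards [Lp.coeFn_smul (c : ℂ) (hw2.toLp _ : L2 d), hw2.coeFn_toLp] with ξ h2 h3
    rw [h2, Pi.smul_apply, h3]
    simp
  have hFg : ∀ᵐ ξ, (𝓕 g : L2 d) ξ = ((c * (q ξ * w ξ) : ℝ) : ℂ) := by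
    simp only [g]
    rw [hsmul]
    filter_upwards [Lp.coeFn_smul (c : ℂ) (hqw2.toLp _ : L2 d), hqw2.coeFn_toLp] with ξ h2 h3
    rw [h2, Pi.smul_apply, h3]
    simp
  have hfg : IsFracLaplacian n f₀ g := by
    rw [isFracLaplacian_L2_iff hd]
    filter_upwards [hFf, hFg] with ξ h2 h3
    rw [h2, h3]
    simp only [q]
    push_cast
    ring
  have hu := (integrable_and_integral_le_weighted hd hn hθ h0 h1 hfg one_pos one_pos).1
  have hnorm : ‖f₀‖ ^ 2 + ‖g‖ ^ 2 = c ^ 2 * K := by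
    rw [← Lp.norm_fourier_eq f₀, ← Lp.norm_fourier_eq g, ← integral_norm_sq_L2,
      ← integral_norm_sq_L2, ← integral_add (integrable_norm_sq_L2 _) (integrable_norm_sq_L2 _),
      ← hpval, ← integral_const_mul]
    refine integral_congr_ae ?_
    filter_upwards [hFf, hFg] with ξ h2 h3
    rw [h2, h3, Complex.norm_real, Complex.norm_real, Real.norm_eq_abs, Real.norm_eq_abs, sq_abs,
      sq_abs, ← hsum]
    ring
  have hval : ∫ ξ, (((2 * Real.pi * ‖ξ‖) ^ j : ℝ) : ℂ) * (𝓕 f₀ : L2 d) ξ = ((c * K : ℝ) : ℂ) := by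
    rw [← hpval, ← integral_const_mul, ← integral_complex_ofReal]
    refine integral_congr_ae ?_
    filter_upwards [hFf] with ξ h2
    rw [h2, ← hpw]
    push_cast
    ring
  refine ⟨hf, g, fourierInvZeroAtInfty _ hu, ?_⟩
  rw [hff₀]
  refine ⟨hfg, isFracLaplacian_fourierInv j f₀ hu, ?_, ?_⟩
  · rw [hnorm]
    positivity
  -- The left side and the value of `D^j f` at the origin both equal `cK`.
  · refine le_trans (le_of_eq ?_) (le_norm_fourierInvZeroAtInfty hu)
    rw [hval, Complex.norm_of_nonneg (by positivity), hnorm, Real.sqrt_mul (by positivity),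
      Real.sqrt_sq hcpos.le, mul_left_comm, Real.mul_self_sqrt hK.le]

end GagliardoNirenberg

/-! ### Sharp constants and the maximizer -/

theorem corollary5p10 (d : ℕ) (hd : 1 ≤ d) (j n θ : ℝ) (hj : 0 ≤ j) (hn : 0 < n)
    (hθ : θ = j / n + (d : ℝ) / (2 * n)) (hθ1 : θ < 1) :
    ∃ S G : ℝ,
      GagliardoNirenberg.IsSharpConstant (GagliardoNirenberg.SobolevInequality d j n) S ∧
      GagliardoNirenberg.IsSharpConstant (GagliardoNirenberg.GNInequality d j n θ) G ∧
      G = S / √((1 - θ) ^ (1 - θ) * θ ^ θ) ∧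
      G = 1 / ((2 : ℝ) ^ ((d : ℝ) / 2) * Real.pi ^ ((d : ℝ) / 4 - 1 / 2) *
            √(Real.Gamma ((d : ℝ) / 2) * ((1 - θ) ^ (1 - θ) * θ ^ θ) * n *
              Real.sin (Real.pi * θ))) ∧
      ∃ hf : MemLp (GagliardoNirenberg.extremal d j n) 2 volume,
        GagliardoNirenberg.IsGNMaximizer d j n θ G (hf.toLp (GagliardoNirenberg.extremal d j n)) := by
  open GagliardoNirenberg in
  have hd' : (0 : ℝ) < d := by exact_mod_cast hd
  have hθ0 : 0 < θ := by
    rw [hθ]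
    positivity
  have hθ1' : 0 < 1 - θ := by linarith
  have hK := sobolevSq_pos hd hn hθ0 hθ1
  obtain ⟨hf, g, h, hfg, hfh, hN, hle⟩ := exists_sobolev_extremal hd hj hn hθ hθ0 hθ1
  set f := hf.toLp (extremal d j n)
  set m := (1 - θ) ^ (1 - θ) * θ ^ θ with hm
  have hmpos : 0 < m := by positivity
  have hS := sobolevInequality hd hn hθ hθ0 hθ1
  have hGN := gnInequality hd hn hθ hθ0 hθ1
  rw [← hm] at hGN
  have hleGN : ‖h‖ ≤ √(sobolevSq d n θ) / √m * (‖f‖ ^ (1 - θ) * ‖g‖ ^ θ) := by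
    obtain ⟨h', hfh', hn'⟩ := hGN f g hfg
    rwa [isFracLaplacian_zeroAtInfty_unique hd hfh hfh']
  have hyoung : ‖f‖ ^ (1 - θ) * ‖g‖ ^ θ / √m ≤ √(‖f‖ ^ 2 + ‖g‖ ^ 2) := by
    refine Real.le_sqrt_of_sq_le ?_
    rw [div_pow, Real.sq_sqrt hmpos.le]
    exact young_product_le (norm_nonneg f) (norm_nonneg g) hθ0 hθ1
  have hsK : 0 < √(sobolevSq d n θ) := Real.sqrt_pos.mpr hK
  have hsm : 0 < √m := Real.sqrt_pos.mpr hmpos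
  have hsN : 0 < √(‖f‖ ^ 2 + ‖g‖ ^ 2) := Real.sqrt_pos.mpr hN
  -- The chain closes: Young and the Sobolev lower bound `hle` give the reverse of `hleGN`.
  have heq : ‖h‖ = √(sobolevSq d n θ) / √m * (‖f‖ ^ (1 - θ) * ‖g‖ ^ θ) := by
    refine le_antisymm hleGN (le_trans (le_of_eq ?_)
      ((mul_le_mul_of_nonneg_left hyoung hsK.le).trans hle))
    ring
  have hhpos : 0 < ‖h‖ := (mul_pos hsK hsN).trans_le hle
  -- Positivity permits cancellation in the minimality of `G`, and also forces `f ≠ 0`.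
  have hP : 0 < ‖f‖ ^ (1 - θ) * ‖g‖ ^ θ := by
    rw [heq] at hhpos
    exact pos_of_mul_pos_right hhpos (by positivity)
  refine ⟨√(sobolevSq d n θ), √(sobolevSq d n θ) / √m, ⟨⟨hsK.le, hS⟩, ?_⟩,
    ⟨⟨by positivity, hGN⟩, ?_⟩, rfl, ?_, hf, ?_, g, h, hfg, hfh, heq⟩
  · rintro C ⟨-, hC⟩
    obtain ⟨h', hfh', hn'⟩ := hC f g hfg
    rw [← isFracLaplacian_zeroAtInfty_unique hd hfh hfh'] at hn'
    exact le_of_mul_le_mul_right (hle.trans hn') hsN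
  · rintro C ⟨-, hC⟩
    obtain ⟨h', hfh', hn'⟩ := hC f g hfg
    rw [← isFracLaplacian_zeroAtInfty_unique hd hfh hfh', heq] at hn'
    exact le_of_mul_le_mul_right hn' hP
  · have hG := Real.Gamma_pos_of_pos (show (0 : ℝ) < d / 2 by positivity)
    have hs : 0 < Real.sin (Real.pi * θ) :=
      Real.sin_pos_of_pos_of_lt_pi (by positivity) (by nlinarith [Real.pi_pos])
    rw [sobolevSq, Real.sqrt_div (by positivity), zpow_neg, Real.sqrt_inv,
      show (2 : ℤ) = ((2 : ℕ) : ℤ) from rfl, zpow_natCast, Real.sqrt_sq (by positivity),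
      show Real.Gamma ((d : ℝ) / 2) * m * n * Real.sin (Real.pi * θ) =
        Real.Gamma ((d : ℝ) / 2) * n * Real.sin (Real.pi * θ) * m by ring,
      Real.sqrt_mul (x := Real.Gamma ((d : ℝ) / 2) * n * Real.sin (Real.pi * θ)) (by positivity) m]
    field_simp
  · intro hf0
    change f = 0 at hf0
    rw [hf0, norm_zero, Real.zero_rpow hθ1'.ne', zero_mul] at hP
    exact lt_irrefl _ hP
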